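/- Let $F_n$ and $L_n$ ($n\in\mathbb Z$) be the Fibonacci and Lucas numbers, given by $X_n=X_{n-1}+X_{n-2}$ for $n\ge 2$ with $F_0=0$, $F_1=1$, $L_0=2$, $L_1=1$ and extended by $F_{-j}=(-1)^{j-1}F_j$, $L_{-j}=(-1)^jL_j$. Let $\alpha=(1+\sqrt5)/2$, $\beta=(1-\sqrt5)/2$; all cube roots are real cube roots and $\log$ is the natural logarithm. For integers $p,q$, $s\in\{\alpha,\beta\}$ and a choice of sign, put $$B^{\pm}_s=\frac{\sqrt[3]{s^{q-3p}}}{(s^qF_p+F_{p+q})^3}\Big(\sqrt[3]{s^{4q}F_p^4}\pm\sqrt[3]{F_{p+q}^4}\mp2\sqrt[3]{s^qF_pF_{p+q}}\,\big(\sqrt[3]{s^{2q}F_p^2}\pm\sqrt[3]{F_{p+q}^2}\big)\Big).$$ Let $p$ and $q$ be integers with $p\le-2$, $q\ge4$ and $|q|>|p|+1$. Put $$T_1=\arctan\Big(\frac{\sqrt3\,\sqrt[3]{F_{p+q}}}{2\sqrt[3]{\alpha^qF_p}+\sqrt[3]{F_{p+q}}}\Big),\qquad T_2=\arctan\Big(\frac{\sqrt3\,\sqrt[3]{F_p}}{2(-1)^q\sqrt[3]{\alpha^qF_{p+q}}+\sqrt[3]{F_p}}\Big),$$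 $$\Lambda_1=\log\Big(\frac{(-1)^pF_q}{\big(\sqrt[3]{\alpha^pF_{p+q}}-\sqrt[3]{\alpha^{p+q}F_p}\big)^3}\Big),\qquad \Lambda_2=\log\Big(\frac{\alpha^{p+q}F_q}{\big(\sqrt[3]{\alpha^qF_{p+q}}-(-1)^q\sqrt[3]{F_p}\big)^3}\Big).$$ Then both series below converge, and $$\frac{1}{F_q\sqrt[3]{F_pF_{p+q}}}\sum_{k=1}^\infty(-1)^{k-p}\Big(\frac{27F_pF_{p+q}}{F_q^2}\Big)^{k}\frac{F_{(2p+q)k}}{\binom{3k}{k}}=\frac{4(-1)^{p-1}\sqrt[3]{F_{p+q}^2F_p^2}\,\big(F_{p+q}^2-(-1)^qF_p^2\big)}{(F_{p+q}+\alpha^qF_p)^2(F_{p+q}+\beta^qF_p)^2}-\frac{2\sqrt{15}}{15}\big(B^+_\alpha T_1+B^+_\beta T_2\big)+\frac{\sqrt5}{15}\big(B^-_\alpha\Lambda_1-B^-_\beta\Lambda_2\big),$$ $$\frac{1}{F_q\sqrt[3]{F_pF_{p+q}}}\sum_{k=1}^\infty(-1)^{k-p}\Big(\frac{27F_pF_{p+q}}{F_q^2}\Big)^{k}\frac{L_{(2p+q)k}}{\binom{3k}{k}}=\frac{4(-1)^{p-q-1}\sqrt[3]{F_{p+q}^2F_p^2}}{F_q}\cdot\frac{F_p^2L_q+(-1)^qF_{p+q}^2L_q+4F_pF_{p+q}}{(F_{p+q}+\alpha^qF_p)^2(F_{p+q}+\beta^qF_p)^2}-\frac{2}{\sqrt3}\big(B^+_\alpha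 T_1-B^+_\beta T_2\big)+\frac13\big(B^-_\alpha\Lambda_1+B^-_\beta\Lambda_2\big).$$ -/

import Mathlib

/-- The real cube root: the unique real `y` with `y ^ 3 = x` (negative for negative `x`). -/
noncomputable def cbrt (x : ℝ) : ℝ :=
  if 0 ≤ x then x ^ (1 / 3 : ℝ) else -((-x) ^ (1 / 3 : ℝ))

theorem cbrt_pow_three (x : ℝ) : cbrt x ^ 3 = x := by
  unfold cbrt
  split_ifs with h
  · rw [← Real.rpow_natCast, ← Real.rpow_mul h]; norm_num
  · have h' : 0 ≤ -x := by linarith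
    rw [neg_pow, ← Real.rpow_natCast ((-x) ^ (1 / 3 : ℝ)), ← Real.rpow_mul h']; norm_num

/-- Lucas numbers with natural index: `L₀ = 2`, `L₁ = 1`, `Lₙ₊₂ = Lₙ₊₁ + Lₙ`. -/
def lucasNat : ℕ → ℤ
  | 0 => 2
  | 1 => 1
  | n + 2 => lucasNat (n + 1) + lucasNat n

/-- Lucas numbers with integer index, extended by `L₋ⱼ = (-1) ^ j * Lⱼ`. -/
def lucas : ℤ → ℤ
  | Int.ofNat n => lucasNat n
  | Int.negSucc n => (-1) ^ (n + 1) * lucasNat (n + 1)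

/-- The `n`-th Fibonacci number (integer index) as a real number. -/
noncomputable abbrev fibR (n : ℤ) : ℝ := (Int.fib n : ℝ)

/-- The `n`-th Lucas number (integer index) as a real number. -/
noncomputable abbrev lucR (n : ℤ) : ℝ := (lucas n : ℝ)

/-- The `k`-th term `(-1)^(k-p) (27 F_p F_{p+q} / F_q²)^k G_{(2p+q)k} / C(3k,k)`,
to be used with `G` the Fibonacci or the Lucas numbers. -/
noncomputable def seriesTerm (G : ℤ → ℝ) (p q : ℤ) (k : ℕ) : ℝ :=
  (-1 : ℝ) ^ ((k : ℤ) - p) * (27 * fibR p * fibR (p + q) / fibR q ^ 2) ^ k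
    * G ((2 * p + q) * k) / (Nat.choose (3 * k) k : ℝ)

/-- The coefficient `B⁺_s` (for given `p`, `q`). -/
noncomputable def Bplus (p q : ℤ) (s : ℝ) : ℝ :=
  cbrt (s ^ (q - 3 * p)) / (s ^ q * fibR p + fibR (p + q)) ^ 3 *
    (cbrt (s ^ (4 * q) * fibR p ^ 4) + cbrt (fibR (p + q) ^ 4)
      - 2 * cbrt (s ^ q * fibR p * fibR (p + q)) *
        (cbrt (s ^ (2 * q) * fibR p ^ 2) + cbrt (fibR (p + q) ^ 2)))

/-- The coefficient `B⁻_s` (for given `p`, `q`). -/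
noncomputable def Bminus (p q : ℤ) (s : ℝ) : ℝ :=
  cbrt (s ^ (q - 3 * p)) / (s ^ q * fibR p + fibR (p + q)) ^ 3 *
    (cbrt (s ^ (4 * q) * fibR p ^ 4) - cbrt (fibR (p + q) ^ 4)
      + 2 * cbrt (s ^ q * fibR p * fibR (p + q)) *
        (cbrt (s ^ (2 * q) * fibR p ^ 2) - cbrt (fibR (p + q) ^ 2)))

/-- The first arctangent. -/
noncomputable def arctanOne (p q : ℤ) : ℝ :=
  Real.arctan (Real.sqrt 3 * cbrt (fibR (p + q)) /
    (2 * cbrt (Real.goldenRatio ^ q * fibR p) + cbrt (fibR (p + q))))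

/-- The second arctangent. -/
noncomputable def arctanTwo (p q : ℤ) : ℝ :=
  Real.arctan (Real.sqrt 3 * cbrt (fibR p) /
    (2 * (-1 : ℝ) ^ q * cbrt (Real.goldenRatio ^ q * fibR (p + q)) + cbrt (fibR p)))

/-- The first logarithm. -/
noncomputable def logOne (p q : ℤ) : ℝ :=
  Real.log ((-1 : ℝ) ^ p * fibR q /
    (cbrt (Real.goldenRatio ^ p * fibR (p + q)) - cbrt (Real.goldenRatio ^ (p + q) * fibR p)) ^ 3)

/-- The second logarithm. -/
noncomputable def logTwo (p q : ℤ) : ℝ :=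
  Real.log (Real.goldenRatio ^ (p + q) * fibR q /
    (cbrt (Real.goldenRatio ^ q * fibR (p + q)) - (-1 : ℝ) ^ q * cbrt (fibR p)) ^ 3)

section

open MeasureTheory

theorem integral_pow_mul_one_sub_pow (m n : ℕ) :
    ((m + n + 1).factorial : ℝ) * ∫ s in (0 : ℝ)..1, s ^ m * (1 - s) ^ n
      = m.factorial * n.factorial := by
  induction m generalizing n with
  | zero =>
    have h : ∫ s in (0 : ℝ)..1, (1 - s) ^ n = 1 / (n + 1) := by
      rw [intervalIntegral.integral_comp_sub_left (fun s : ℝ => s ^ n) 1]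
      simp
    have hn : (n : ℝ) + 1 ≠ 0 := by positivity
    simp only [pow_zero, one_mul, zero_add, h, Nat.factorial_succ, Nat.factorial_zero]
    push_cast
    field_simp
  | succ m ih =>
    have hd : ∀ s : ℝ, HasDerivAt (fun s : ℝ => s ^ (m + 1) * (1 - s) ^ (n + 1))
        ((m + 1) * (s ^ m * (1 - s) ^ (n + 1)) - (n + 1) * (s ^ (m + 1) * (1 - s) ^ n)) s := by
      intro s
      have h1 : HasDerivAt (fun s : ℝ => 1 - s) (-1) s := by
        simpa using (hasDerivAt_id s).const_sub 1
      have h := (hasDerivAt_pow (m + 1) s).mul (h1.pow (n + 1))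
      refine h.congr_deriv ?_
      push_cast
      simp only [Pi.pow_apply]
      ring
    have hi : ∀ a b : ℕ, IntervalIntegrable (fun s : ℝ => s ^ a * (1 - s) ^ b) volume 0 1 :=
      fun a b => Continuous.intervalIntegrable (by fun_prop) _ _
    have hz := intervalIntegral.integral_eq_sub_of_hasDerivAt (a := 0) (b := 1)
      (fun s _ => hd s) (Continuous.intervalIntegrable (by fun_prop) _ _)
    rw [intervalIntegral.integral_sub ((hi _ _).const_mul _) ((hi _ _).const_mul _),
      intervalIntegral.integral_const_mul, intervalIntegral.integral_const_mul] at hz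
    norm_num at hz
    have h2 := ih (n + 1)
    rw [show m + (n + 1) + 1 = m + 1 + n + 1 by ring] at h2
    rw [Nat.factorial_succ n] at h2
    rw [Nat.factorial_succ m]
    push_cast at h2 ⊢
    have hn : (n : ℝ) + 1 ≠ 0 := by positivity
    apply mul_left_cancel₀ hn
    linear_combination (m + 1 : ℝ) * h2 - ((m + 1 + n + 1).factorial : ℝ) * hz

theorem inv_choose_three_mul_eq_integral (k : ℕ) :
    1 / (Nat.choose (3 * (k + 1)) (k + 1) : ℝ)
      = ∫ s in (0 : ℝ)..1, (k + 1) * (s ^ k * (1 - s) ^ (2 * k + 2)) := by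
  have h := integral_pow_mul_one_sub_pow k (2 * k + 2)
  have hc : ((3 * (k + 1)).choose (k + 1) : ℝ) * (k + 1).factorial * (2 * k + 2).factorial
      = (3 * (k + 1)).factorial := by
    have := Nat.choose_mul_factorial_mul_factorial (show k + 1 ≤ 3 * (k + 1) by omega)
    rw [show 3 * (k + 1) - (k + 1) = 2 * k + 2 by omega] at this
    exact_mod_cast this
  rw [show k + (2 * k + 2) + 1 = 3 * (k + 1) by ring, ← hc, Nat.factorial_succ k] at h
  rw [intervalIntegral.integral_const_mul]
  have h0 : ((3 * (k + 1)).choose (k + 1) : ℝ) ≠ 0 := by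
    exact_mod_cast (Nat.choose_pos (show k + 1 ≤ 3 * (k + 1) by omega)).ne'
  have h1 : (k.factorial : ℝ) ≠ 0 := by positivity
  have h2 : ((2 * k + 2).factorial : ℝ) ≠ 0 := by positivity
  rw [div_eq_iff h0]
  apply mul_left_cancel₀ (mul_ne_zero h1 h2)
  push_cast at h
  linear_combination -h

theorem mul_one_sub_sq_le {s : ℝ} (h1 : s ≤ 1) : s * (1 - s) ^ 2 ≤ 4 / 27 := by
  nlinarith [mul_nonneg (sq_nonneg (3 * s - 1)) (by linarith : (0 : ℝ) ≤ 4 - 3 * s)]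

theorem abs_mul_mul_one_sub_sq_lt {x s : ℝ} (hx : |x| < 27 / 4) (h0 : 0 ≤ s) (h1 : s ≤ 1) :
    |x * (s * (1 - s) ^ 2)| < 1 := by
  have h2 : 0 ≤ s * (1 - s) ^ 2 := by positivity
  rw [abs_mul, abs_of_nonneg h2]
  nlinarith [mul_one_sub_sq_le h1, abs_nonneg x]

/-- Integral representation of `∑ x ^ k / C(3k, k)` over `k ≥ 1`. -/
theorem hasSum_pow_div_choose_integral {x : ℝ} (hx : |x| < 27 / 4) :
    HasSum (fun k : ℕ => x ^ (k + 1) / (Nat.choose (3 * (k + 1)) (k + 1) : ℝ))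
      (∫ s in (0 : ℝ)..1, x * (1 - s) ^ 2 / (1 - x * (s * (1 - s) ^ 2)) ^ 2) := by
  let f : ℕ → C(ℝ, ℝ) := fun k =>
    ⟨fun s => x ^ (k + 1) * ((k + 1) * (s ^ k * (1 - s) ^ (2 * k + 2))), by fun_prop⟩
  have hr : |x| * (4 / 27) < 1 := by linarith
  have hr0 : 0 ≤ |x| * (4 / 27) := by positivity
  have hsum : Summable fun k : ℕ => |x| * ((k + 1) * (|x| * (4 / 27)) ^ k) := by
    apply Summable.mul_left
    have := (hasSum_choose_mul_geometric_of_norm_lt_one 1 (r := |x| * (4 / 27))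
      (by rwa [Real.norm_of_nonneg hr0])).summable
    simpa using this
  have hnorm : ∀ k, ‖(f k).restrict (⟨Set.uIcc (0 : ℝ) 1, isCompact_uIcc⟩ :
      TopologicalSpace.Compacts ℝ)‖ ≤ |x| * ((k + 1) * (|x| * (4 / 27)) ^ k) := by
    intro k
    rw [ContinuousMap.norm_le _ (by positivity)]
    rintro ⟨s, hs⟩
    have hs' : s ∈ Set.Icc (0 : ℝ) 1 := by simpa using hs
    have h3 : 0 ≤ s * (1 - s) ^ 2 := mul_nonneg hs'.1 (sq_nonneg _)
    have h4 : (1 - s) ^ 2 ≤ 1 := by nlinarith [hs'.1, hs'.2]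
    have h5 : (s * (1 - s) ^ 2) ^ k ≤ (4 / 27) ^ k :=
      pow_le_pow_left₀ h3 (mul_one_sub_sq_le hs'.2) k
    have h6 : f k s = x ^ (k + 1) * ((k + 1) * ((s * (1 - s) ^ 2) ^ k * (1 - s) ^ 2)) := by
      simp only [f, ContinuousMap.coe_mk, mul_pow, ← pow_mul]; ring
    have h7 : 0 ≤ (s * (1 - s) ^ 2) ^ k * (1 - s) ^ 2 := by positivity
    calc ‖f k s‖ = |x| ^ (k + 1) * ((k + 1) * ((s * (1 - s) ^ 2) ^ k * (1 - s) ^ 2)) := by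
          rw [h6, norm_mul, norm_pow, Real.norm_eq_abs, Real.norm_of_nonneg (by positivity)]
      _ ≤ |x| ^ (k + 1) * ((k + 1) * ((4 / 27) ^ k * 1)) := by gcongr
      _ = _ := by ring
  have h := intervalIntegral.hasSum_intervalIntegral_of_summable_norm (a := 0) (b := 1) (f := f)
    (Summable.of_nonneg_of_le (fun _ => norm_nonneg _) hnorm hsum)
  have hterm : ∀ k, ∫ s in (0 : ℝ)..1, f k s
      = x ^ (k + 1) / (Nat.choose (3 * (k + 1)) (k + 1) : ℝ) := by
    intro k
    simp only [f, ContinuousMap.coe_mk]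
    rw [intervalIntegral.integral_const_mul, ← inv_choose_three_mul_eq_integral]
    ring
  have hint : ∫ s in (0 : ℝ)..1, ∑' k, f k s
      = ∫ s in (0 : ℝ)..1, x * (1 - s) ^ 2 / (1 - x * (s * (1 - s) ^ 2)) ^ 2 := by
    apply intervalIntegral.integral_congr
    intro s hs
    have hs' : s ∈ Set.Icc (0 : ℝ) 1 := by simpa using hs
    have hg := hasSum_choose_mul_geometric_of_norm_lt_one 1
      ((Real.norm_eq_abs _).trans_lt (abs_mul_mul_one_sub_sq_lt hx hs'.1 hs'.2))
    have hg' := hg.mul_left (x * (1 - s) ^ 2)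
    refine Eq.trans ?_ (hg'.tsum_eq.trans ?_)
    · refine tsum_congr fun k => ?_
      simp only [f, ContinuousMap.coe_mk, Nat.choose_one_right]
      rw [mul_pow, mul_pow, ← pow_mul]
      push_cast
      ring
    · ring
  simp only [hterm, hint] at h
  exact h

end

theorem HasDerivAt.arctan_div {f g : ℝ → ℝ} {f' g' s : ℝ} (hf : HasDerivAt f f' s)
    (hg : HasDerivAt g g' s) (h : g s ≠ 0) :
    HasDerivAt (fun s => Real.arctan (f s / g s))
      ((f' * g s - f s * g') / (g s ^ 2 + f s ^ 2)) s := by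
  refine (hf.div hg h).arctan.congr_deriv ?_
  have h1 : g s ^ 2 + f s ^ 2 ≠ 0 := by positivity
  have h2 : 1 + (f s / g s) ^ 2 ≠ 0 := by positivity
  simp only [Pi.div_apply]
  field_simp

theorem hasDerivAt_quadratic (c₀ c₁ c₂ s : ℝ) :
    HasDerivAt (fun s : ℝ => c₂ * s ^ 2 + c₁ * s + c₀) (2 * c₂ * s + c₁) s := by
  have h := (((hasDerivAt_pow 2 s).const_mul c₂).add ((hasDerivAt_id s).const_mul c₁)).add_const c₀
  refine (h.congr_deriv ?_)
  norm_num
  ring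

theorem hasDerivAt_affine (c₀ c₁ s : ℝ) :
    HasDerivAt (fun s : ℝ => c₁ * s + c₀) c₁ s := by
  simpa using ((hasDerivAt_id s).const_mul c₁).add_const c₀

/-- The value of `∑ x ^ k / C(3k, k)` over `k ≥ 1` at `x = -27 t ^ 3 / (1 - t ^ 3) ^ 2`. -/
noncomputable def invChooseSum (t : ℝ) : ℝ :=
  -4 * t ^ 3 / (1 + t ^ 3) ^ 2
    + 2 / Real.sqrt 3 * ((1 - t ^ 3) * t * (1 - 2 * t - 2 * t ^ 3 + t ^ 4) / (1 + t ^ 3) ^ 3)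
      * Real.arctan (Real.sqrt 3 * t / (2 + t))
    - 1 / 3 * ((1 - t ^ 3) * t * (1 + 2 * t - 2 * t ^ 3 - t ^ 4) / (1 + t ^ 3) ^ 3)
      * Real.log ((1 - t ^ 3) / (1 - t) ^ 3)

set_option maxHeartbeats 1600000 in
theorem integral_eq_invChooseSum {t : ℝ} (ht : -(7 / 10) < t) (ht1 : t < 1) :
    ∫ s in (0 : ℝ)..1, -27 * t ^ 3 * (1 - t ^ 3) ^ 2 * (1 - s) ^ 2
        / ((1 - t ^ 3) ^ 2 + 27 * t ^ 3 * (s * (1 - s) ^ 2)) ^ 2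
      = invChooseSum t := by
  obtain ⟨r, hr⟩ : ∃ r, r = Real.sqrt 3 := ⟨_, rfl⟩
  have hr2 : r ^ 2 = 3 := by rw [hr]; norm_num
  have hr0 : r ≠ 0 := by rintro rfl; norm_num at hr2
  have hm : 0 < 1 - t ^ 3 := by nlinarith [sq_nonneg (2 * t + 1)]
  have hn : 0 < 1 + t ^ 3 := by nlinarith [sq_nonneg (2 * t - 1)]
  have ht' : 0 < 1 - t := by linarith
  have hq : 0 < 1 + t + t ^ 2 := by nlinarith [sq_nonneg (2 * t + 1)]
  obtain ⟨a, ha⟩ : ∃ a, a = -(2 / 9) * (1 - t ^ 3) * t * (1 - t ^ 2) * (1 + t) ^ 2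
    / (1 + t ^ 3) ^ 3 := ⟨_, rfl⟩
  obtain ⟨e, he⟩ : ∃ e, e = 2 * r / 9 * (1 - t ^ 3) * t * (1 - 2 * t - 2 * t ^ 3 + t ^ 4)
    / (1 + t ^ 3) ^ 3 := ⟨_, rfl⟩
  obtain ⟨ρ, hρ⟩ : ∃ ρ, ρ = (1 - t ^ 3) ^ 2 / (1 + t ^ 3) ^ 2 := ⟨_, rfl⟩
  obtain ⟨c₂, hc₂⟩ : ∃ c, c = ρ * (6 * t ^ 3) := ⟨_, rfl⟩
  obtain ⟨c₁, hc₁⟩ : ∃ c, c = ρ * (-10 * t ^ 3) := ⟨_, rfl⟩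
  obtain ⟨c₀, hc₀⟩ : ∃ c, c = ρ * ((1 - t ^ 3) ^ 2 / 3 + 4 * t ^ 3) := ⟨_, rfl⟩
  have hρ' : ρ * (1 + t ^ 3) ^ 2 = (1 - t ^ 3) ^ 2 := by rw [hρ]; field_simp
  let R : ℝ → ℝ := fun s => c₂ * s ^ 2 + c₁ * s + c₀
  let L : ℝ → ℝ := fun s => 3 * t * s + (1 - t) ^ 2
  let Re : ℝ → ℝ := fun s => -(3 / 2) * t * s + (1 + t - t ^ 2 / 2)
  let Im : ℝ → ℝ := fun s => 3 / 2 * r * t * s + r / 2 * (-2 * t - t ^ 2)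
  let Q : ℝ → ℝ := fun s => 9 * t ^ 2 * s ^ 2 + (-3 * t * (1 + 4 * t + t ^ 2)) * s
    + (1 + t + t ^ 2) ^ 2
  have hQ : ∀ s, Re s ^ 2 + Im s ^ 2 = Q s := by
    intro s
    simp only [Re, Im, Q]
    linear_combination (3 / 2 * t * s + (-2 * t - t ^ 2) / 2) ^ 2 * hr2
  have hLQ : ∀ s, L s * Q s = (1 - t ^ 3) ^ 2 + 27 * t ^ 3 * (s * (1 - s) ^ 2) := by
    intro s; simp only [L, Q]; ring
  have hRe : ∀ s ∈ Set.uIcc (0 : ℝ) 1, 0 < Re s := by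
    intro s hs
    have hs' : s ∈ Set.Icc (0 : ℝ) 1 := by simpa using hs
    have h0 : 0 < 1 + t - t ^ 2 / 2 := by nlinarith
    have h1 : 0 < 1 - t / 2 - t ^ 2 / 2 := by nlinarith
    have : Re s = (1 - s) * (1 + t - t ^ 2 / 2) + s * (1 - t / 2 - t ^ 2 / 2) := by
      simp only [Re]; ring
    rw [this]
    rcases eq_or_lt_of_le hs'.1 with h | h
    · simp [← h]; linarith
    · have : 0 ≤ 1 - s := by linarith [hs'.2]
      positivity
  have hL : ∀ s ∈ Set.uIcc (0 : ℝ) 1, 0 < L s := by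
    intro s hs
    have hs' : s ∈ Set.Icc (0 : ℝ) 1 := by simpa using hs
    have : L s = (1 - s) * (1 - t) ^ 2 + s * (1 + t + t ^ 2) := by simp only [L]; ring
    rw [this]
    rcases eq_or_lt_of_le hs'.1 with h | h
    · rw [← h]; simp; positivity
    · have : 0 ≤ 1 - s := by linarith [hs'.2]
      positivity
  have hQp : ∀ s ∈ Set.uIcc (0 : ℝ) 1, 0 < Q s := by
    intro s hs
    have := hRe s hs
    rw [← hQ]; positivity
  let A : ℝ → ℝ := fun s => R s / (L s * Q s) + a * Real.log (L s) - a / 2 * Real.log (Q s)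
    + e * Real.arctan (Im s / Re s)
  have hA : ∀ s ∈ Set.uIcc (0 : ℝ) 1, HasDerivAt A (-27 * t ^ 3 * (1 - t ^ 3) ^ 2 * (1 - s) ^ 2
        / ((1 - t ^ 3) ^ 2 + 27 * t ^ 3 * (s * (1 - s) ^ 2)) ^ 2) s := by
    intro s hs
    have hL0 := (hL s hs).ne'
    have hQ0 := (hQp s hs).ne'
    have dR : HasDerivAt R _ s := hasDerivAt_quadratic _ _ _ s
    have dL : HasDerivAt L _ s := hasDerivAt_affine _ _ s
    have dQ : HasDerivAt Q _ s := hasDerivAt_quadratic _ _ _ s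
    have dRe : HasDerivAt Re _ s := hasDerivAt_affine _ _ s
    have dIm : HasDerivAt Im _ s := hasDerivAt_affine _ _ s
    have d := (((dR.div (dL.mul dQ) (mul_ne_zero hL0 hQ0)).add ((dL.log hL0).const_mul a)).sub
      ((dQ.log hQ0).const_mul (a / 2))).add ((dIm.arctan_div dRe (hRe s hs).ne').const_mul e)
    refine d.congr_deriv ?_
    rw [hQ, ← hLQ]
    simp only [Pi.mul_apply]
    have hK : 3 / 2 * r * t * Re s - Im s * (-(3 / 2) * t) = 3 * r / 2 * t * (1 - t ^ 2) := by
      simp only [Re, Im]; ring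
    rw [hK]
    have hE : a * (3 * t) * Q s - a / 2 * (2 * (9 * t ^ 2) * s + (-3 * t * (1 + 4 * t + t ^ 2)))
        * L s + e * (3 * r / 2 * t * (1 - t ^ 2)) * L s
        = ρ * (6 * t ^ 3 * s - 8 * t ^ 3) := by
      have he' : e * (3 * r / 2 * t * (1 - t ^ 2)) = (1 - t ^ 3) * t ^ 2 * (1 - t ^ 2)
          * (1 - 2 * t - 2 * t ^ 3 + t ^ 4) / (1 + t ^ 3) ^ 3 := by
        rw [he]; field_simp; rw [hr2]; ring
      rw [he', ha, hρ]
      simp only [Q, L]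
      field_simp
      ring
    have hN := hLQ s
    have hcomb : (2 * c₂ * s + c₁) * (L s * Q s) - R s * (3 * t * Q s
        + L s * (2 * (9 * t ^ 2) * s + (-3 * t * (1 + 4 * t + t ^ 2))))
        + ρ * (6 * t ^ 3 * s - 8 * t ^ 3) * (L s * Q s)
        = -27 * t ^ 3 * (1 - t ^ 3) ^ 2 * (1 - s) ^ 2 := by
      have hN' : 3 * t * Q s
        + L s * (2 * (9 * t ^ 2) * s + (-3 * t * (1 + 4 * t + t ^ 2)))
        = 27 * t ^ 3 * (1 - s) * (1 - 3 * s) := by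
        simp only [L, Q]; ring
      rw [hN', hN]
      simp only [R]
      rw [hc₀, hc₁, hc₂]
      linear_combination (-27 * t ^ 3 * (1 - s) ^ 2) * hρ'
    rw [← hcomb, ← hE]
    field_simp
    ring
  have hcont : ContinuousOn (fun s : ℝ => -27 * t ^ 3 * (1 - t ^ 3) ^ 2 * (1 - s) ^ 2
        / ((1 - t ^ 3) ^ 2 + 27 * t ^ 3 * (s * (1 - s) ^ 2)) ^ 2) (Set.uIcc 0 1) := by
    apply ContinuousOn.div (by fun_prop) (by fun_prop)
    intro s hs
    rw [← hLQ]
    have := hL s hs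
    have := hQp s hs
    positivity
  rw [intervalIntegral.integral_eq_sub_of_hasDerivAt hA hcont.intervalIntegrable]
  have hlog : Real.log ((1 - t ^ 3) / (1 - t) ^ 3)
      = Real.log (1 + t + t ^ 2) - 2 * Real.log (1 - t) := by
    rw [show (1 - t ^ 3) / (1 - t) ^ 3 = (1 + t + t ^ 2) / (1 - t) ^ 2 by field_simp; ring,
      Real.log_div hq.ne' (by positivity), Real.log_pow]
    norm_num
  have hQ1 : Q 1 = (1 - t) ^ 2 * (1 + t + t ^ 2) := by simp only [Q]; ring
  have hQ0 : Q 0 = (1 + t + t ^ 2) ^ 2 := by simp only [Q]; ring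
  have hL1 : L 1 = 1 + t + t ^ 2 := by simp only [L]; ring
  have hL0 : L 0 = (1 - t) ^ 2 := by simp only [L]; ring
  have h2t : 0 < 2 + t := by linarith
  have hIR1 : Im 1 / Re 1 = r * t / (2 + t) := by
    have h1 : Re 1 = (1 - t) * (2 + t) / 2 := by simp only [Re]; ring
    have h2 : Im 1 = r * t * (1 - t) / 2 := by simp only [Im]; ring
    rw [h1, h2]
    field_simp
  have hIR0 : Real.arctan (Im 0 / Re 0) = -(2 * Real.arctan (r * t / (2 + t))) := by
    have hr1 : 0 < r := by rw [hr]; positivity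
    have hr3 : r < 1733 / 1000 := by nlinarith
    have hlo : -1 < r * t / (2 + t) := by
      rw [lt_div_iff₀ h2t]; nlinarith
    have hhi : r * t / (2 + t) < 1 := by
      rw [div_lt_iff₀ h2t]; nlinarith
    rw [Real.two_mul_arctan hlo hhi, ← Real.arctan_neg]
    congr 1
    have h1 : Re 0 = 1 + t - t ^ 2 / 2 := by simp only [Re]; ring
    have h2 : Im 0 = r / 2 * (-2 * t - t ^ 2) := by simp only [Im]; ring
    have h3 : 0 < 1 + t - t ^ 2 / 2 := by nlinarith
    have h4 : 1 - (r * t / (2 + t)) ^ 2 = 4 * (1 + t - t ^ 2 / 2) / (2 + t) ^ 2 := by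
      rw [div_pow, mul_pow, hr2]; field_simp; ring
    rw [h1, h2, h4]
    field_simp
    ring
  have hN1 : L 1 * Q 1 = (1 - t ^ 3) ^ 2 := by rw [hLQ]; ring
  have hN0 : L 0 * Q 0 = (1 - t ^ 3) ^ 2 := by rw [hLQ]; ring
  have hR : R 1 / (1 - t ^ 3) ^ 2 - R 0 / (1 - t ^ 3) ^ 2 = -4 * t ^ 3 / (1 + t ^ 3) ^ 2 := by
    simp only [R]
    rw [hc₀, hc₁, hc₂, hρ]
    field_simp
    ring
  simp only [A]
  rw [hN1, hN0, hIR1, hIR0, hQ1, hQ0, hL1, hL0, Real.log_mul (by positivity) hq.ne', Real.log_pow,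
    Real.log_pow, invChooseSum, hlog, ← hr, ← hR]
  have he' : 2 / r * ((1 - t ^ 3) * t * (1 - 2 * t - 2 * t ^ 3 + t ^ 4) / (1 + t ^ 3) ^ 3)
      = 3 * e := by
    rw [he]
    field_simp
    linear_combination (-3 * t * (1 - 2 * t - 2 * t ^ 3 + t ^ 4)) * hr2
  have ha' : 1 / 3 * ((1 - t ^ 3) * t * (1 + 2 * t - 2 * t ^ 3 - t ^ 4) / (1 + t ^ 3) ^ 3)
      = -(3 / 2) * a := by
    rw [ha]
    field_simp
    ring
  rw [he', ha']
  push_cast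
  ring

theorem hasSum_pow_div_choose {t : ℝ} (ht : -(1 / 4) < t ^ 3) (ht1 : t ^ 3 < 1 / 6) :
    HasSum (fun k : ℕ => (-27 * t ^ 3 / (1 - t ^ 3) ^ 2) ^ (k + 1)
      / (Nat.choose (3 * (k + 1)) (k + 1) : ℝ)) (invChooseSum t) := by
  have h1 : t < 1 := by
    by_contra! h
    nlinarith [one_le_pow₀ h (n := 3)]
  have h2 : -(7 / 10) < t := by
    by_contra! h
    have : (7 / 10 : ℝ) ^ 3 ≤ (-t) ^ 3 := pow_le_pow_left₀ (by norm_num) (by linarith) 3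
    rw [Odd.neg_pow (by decide)] at this
    norm_num at this
    linarith
  have hm : 0 < 1 - t ^ 3 := by linarith
  have hx : |-27 * t ^ 3 / (1 - t ^ 3) ^ 2| < 27 / 4 := by
    rw [abs_lt, lt_div_iff₀ (by positivity), div_lt_iff₀ (by positivity)]
    constructor <;> nlinarith
  have hint : ∀ s : ℝ, -27 * t ^ 3 / (1 - t ^ 3) ^ 2 * (1 - s) ^ 2
      / (1 - -27 * t ^ 3 / (1 - t ^ 3) ^ 2 * (s * (1 - s) ^ 2)) ^ 2
      = -27 * t ^ 3 * (1 - t ^ 3) ^ 2 * (1 - s) ^ 2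
        / ((1 - t ^ 3) ^ 2 + 27 * t ^ 3 * (s * (1 - s) ^ 2)) ^ 2 := by
    intro s
    have : 1 - -27 * t ^ 3 / (1 - t ^ 3) ^ 2 * (s * (1 - s) ^ 2)
        = ((1 - t ^ 3) ^ 2 + 27 * t ^ 3 * (s * (1 - s) ^ 2)) / (1 - t ^ 3) ^ 2 := by
      field_simp; ring
    rw [this, div_pow, div_div_eq_mul_div]
    congr 1
    field_simp
  have h := hasSum_pow_div_choose_integral hx
  simp only [hint] at h
  rwa [integral_eq_invChooseSum h2 h1] at h

theorem cbrt_eq_of_pow_three {x y : ℝ} (h : y ^ 3 = x) : cbrt x = y :=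
  (Odd.strictMono_pow (by decide : Odd 3)).injective ((cbrt_pow_three x).trans h.symm)

theorem cbrt_mul (x y : ℝ) : cbrt (x * y) = cbrt x * cbrt y :=
  cbrt_eq_of_pow_three (by rw [mul_pow, cbrt_pow_three, cbrt_pow_three])

theorem cbrt_pow (x : ℝ) (n : ℕ) : cbrt (x ^ n) = cbrt x ^ n :=
  cbrt_eq_of_pow_three (by rw [← pow_mul, mul_comm, pow_mul, cbrt_pow_three])

theorem cbrt_zpow_mul_three (x : ℝ) (n : ℤ) : cbrt (x ^ (3 * n)) = x ^ n :=
  cbrt_eq_of_pow_three (by rw [← zpow_natCast, ← zpow_mul, mul_comm n]; rfl)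

theorem cbrt_ne_zero {x : ℝ} (h : x ≠ 0) : cbrt x ≠ 0 := by
  intro h0
  apply h
  rw [← cbrt_pow_three x, h0]
  norm_num

section

open Real goldenRatio

theorem goldenConj_zpow (n : ℤ) : ψ ^ n = (-1) ^ n * (φ ^ n)⁻¹ := by
  rw [← zpow_neg, ← inv_zpow', ← mul_zpow, inv_goldenRatio]
  congr 1
  ring

theorem lucR_eq (n : ℤ) : lucR n = φ ^ n + ψ ^ n := by
  have hnat : ∀ n : ℕ, (lucasNat n : ℝ) = φ ^ n + ψ ^ n := by
    intro n
    induction n using Nat.twoStepInduction with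
    | zero => norm_num [lucasNat]
    | one => simp [lucasNat, goldenRatio_add_goldenConj]
    | more n h1 h2 =>
      rw [lucasNat]
      push_cast
      rw [h1, h2]
      linear_combination (-φ ^ n) * goldenRatio_sq - ψ ^ n * goldenConj_sq
  unfold lucR
  rcases n with n | n
  · simpa [lucas] using hnat n
  · have h : φ ^ (n + 1) * ψ ^ (n + 1) = (-1) ^ (n + 1) := by
      rw [← mul_pow, goldenRatio_mul_goldenConj]
    have h1 : φ ^ (n + 1) ≠ 0 := pow_ne_zero _ goldenRatio_ne_zero
    have h2 : ψ ^ (n + 1) ≠ 0 := pow_ne_zero _ goldenConj_ne_zero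
    have h3 : ((-1 : ℝ) ^ (n + 1)) ^ 2 = 1 := by rw [← pow_mul, mul_comm, pow_mul]; simp
    simp only [lucas, zpow_negSucc]
    push_cast
    rw [hnat]
    field_simp
    linear_combination (-1) ^ (n + 1) * (φ ^ (n + 1) + ψ ^ (n + 1)) * h
      + (φ ^ (n + 1) + ψ ^ (n + 1)) * h3

theorem neg_one_zpow_sq (n : ℤ) : ((-1 : ℝ) ^ n) ^ 2 = 1 := by
  rw [← zpow_natCast, ← zpow_mul, mul_comm, zpow_mul]; simp

theorem fib_le_goldenRatio_pow (n : ℕ) : (Nat.fib (n + 1) : ℝ) ≤ φ ^ n := by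
  induction n using Nat.twoStepInduction with
  | zero => simp
  | one => simpa using one_lt_goldenRatio.le
  | more n h1 h2 =>
    rw [Nat.fib_add_two (n := n + 1)]
    push_cast
    have : φ ^ (n + 2) = φ ^ n + φ ^ (n + 1) := by
      linear_combination φ ^ n * goldenRatio_sq
    linarith

/-- The ratio `τ` for which the series is evaluated at `-27 τ / (1 - τ) ^ 2`. -/
theorem fib_ratio_bounds {M P : ℕ} (hM : 2 ≤ M) (hP : 2 ≤ P) {τ : ℝ}
    (hτ : τ = (-1) ^ (P + 1) * Nat.fib M / (φ ^ (M + P) * Nat.fib P)) :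
    -(1 / 4) < τ ∧ τ < 1 / 6 := by
  have hφ := goldenRatio_pos
  have hφ1 : 1.6 < φ := by
    unfold goldenRatio
    have : 2.2 < √5 := by
      apply Real.lt_sqrt_of_sq_lt; norm_num
    linarith
  obtain ⟨M, rfl⟩ : ∃ m, M = m + 1 := ⟨M - 1, by omega⟩
  have hfM : (0 : ℝ) < Nat.fib (M + 1) := by exact_mod_cast Nat.fib_pos.mpr (by omega)
  have hfP : (0 : ℝ) < Nat.fib P := by exact_mod_cast Nat.fib_pos.mpr (by omega)
  have hden : 0 < φ ^ (M + 1 + P) * Nat.fib P := by positivity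
  have hφ4 : 4 < φ ^ 3 := by nlinarith [goldenRatio_sq]
  have key : ∀ c : ℝ, 0 < c → c < φ ^ (P + 1) * Nat.fib P →
      (Nat.fib (M + 1) : ℝ) / (φ ^ (M + 1 + P) * Nat.fib P) < 1 / c := by
    intro c hc h
    rw [div_lt_div_iff₀ hden hc]
    have h1 := fib_le_goldenRatio_pow M
    have h2 : 0 < φ ^ M := by positivity
    calc (Nat.fib (M + 1) : ℝ) * c ≤ φ ^ M * c := by gcongr
      _ < φ ^ M * (φ ^ (P + 1) * Nat.fib P) := by gcongr
      _ = _ := by ring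
  have hpos : 0 < (Nat.fib (M + 1) : ℝ) / (φ ^ (M + 1 + P) * Nat.fib P) := by positivity
  rw [mul_div_assoc] at hτ
  rcases eq_or_lt_of_le hP with h2 | h3
  · subst h2
    have h := key 4 (by norm_num) (by simpa using hφ4)
    rw [show ((-1 : ℝ)) ^ (2 + 1) = -1 by norm_num] at hτ
    exact ⟨by linarith, by linarith⟩
  · have hf2 : (2 : ℝ) ≤ Nat.fib P := by
      have : Nat.fib 3 ≤ Nat.fib P := Nat.fib_mono h3
      exact_mod_cast this
    have hφ6 : φ ^ 3 ≤ φ ^ (P + 1) := pow_le_pow_right₀ (by linarith) (by omega)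
    have h := key 8 (by norm_num) (by nlinarith)
    rcases neg_one_pow_eq_or ℝ (P + 1) with hs | hs <;> rw [hs] at hτ <;>
      exact ⟨by linarith, by linarith⟩

theorem invChooseSum_div {a b : ℝ} (hb : b ≠ 0) :
    invChooseSum (a / b) = -4 * a ^ 3 * b ^ 3 / (b ^ 3 + a ^ 3) ^ 2
      + 2 / √3 * ((b ^ 3 - a ^ 3) * (a * b) * (b ^ 4 + a ^ 4 - 2 * (b * a) * (b ^ 2 + a ^ 2))
          / (b ^ 3 + a ^ 3) ^ 3) * arctan (√3 * a / (2 * b + a))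
      - 1 / 3 * ((b ^ 3 - a ^ 3) * (a * b) * (b ^ 4 - a ^ 4 + 2 * (b * a) * (b ^ 2 - a ^ 2))
          / (b ^ 3 + a ^ 3) ^ 3) * log ((b ^ 3 - a ^ 3) / (b - a) ^ 3) := by
  have h1 : 1 + (a / b) ^ 3 = (b ^ 3 + a ^ 3) / b ^ 3 := by field_simp
  have h2 : 1 - (a / b) ^ 3 = (b ^ 3 - a ^ 3) / b ^ 3 := by field_simp
  have h3 : 1 - a / b = (b - a) / b := by field_simp
  have h4 : 2 + a / b = (2 * b + a) / b := by field_simp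
  have h5 : 1 - 2 * (a / b) - 2 * (a / b) ^ 3 + (a / b) ^ 4
      = (b ^ 4 + a ^ 4 - 2 * (b * a) * (b ^ 2 + a ^ 2)) / b ^ 4 := by field_simp; ring
  have h6 : 1 + 2 * (a / b) - 2 * (a / b) ^ 3 - (a / b) ^ 4
      = (b ^ 4 - a ^ 4 + 2 * (b * a) * (b ^ 2 - a ^ 2)) / b ^ 4 := by field_simp; ring
  have h7 : √3 * (a / b) / ((2 * b + a) / b) = √3 * a / (2 * b + a) := by
    rw [← mul_div_assoc, div_div_div_cancel_right₀ hb]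
  have h8 : (b ^ 3 - a ^ 3) / b ^ 3 / ((b - a) / b) ^ 3 = (b ^ 3 - a ^ 3) / (b - a) ^ 3 := by
    rw [div_pow, div_div_div_cancel_right₀ (pow_ne_zero 3 hb)]
  rw [invChooseSum, h1, h2, h3, h4, h5, h6, h7, h8]
  congr 1
  · congr 1
    · field_simp
    · congr 2
      field_simp
  · congr 2
    field_simp

theorem cbrt_zpow_sub_three_mul {s : ℝ} (hs : s ≠ 0) (p q : ℤ) :
    cbrt (s ^ (q - 3 * p)) = cbrt (s ^ q) * (s ^ p)⁻¹ := by
  rw [sub_eq_add_neg, zpow_add₀ hs, cbrt_mul, ← mul_neg, cbrt_zpow_mul_three, zpow_neg]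

theorem cbrt_zpow_natCast_mul (s : ℝ) (n : ℕ) (q : ℤ) :
    cbrt (s ^ ((n : ℤ) * q)) = cbrt (s ^ q) ^ n := by
  rw [mul_comm, zpow_mul, zpow_natCast, cbrt_pow]

theorem Bplus_eq {s : ℝ} (hs : s ≠ 0) {p q : ℤ} {b a : ℝ}
    (hb : b = cbrt (s ^ q) * cbrt (fibR p)) (ha : a = cbrt (fibR (p + q))) :
    Bplus p q s = cbrt (s ^ q) * (s ^ p)⁻¹ / (b ^ 3 + a ^ 3) ^ 3
      * (b ^ 4 + a ^ 4 - 2 * (b * a) * (b ^ 2 + a ^ 2)) := by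
  have hb3 : b ^ 3 = s ^ q * fibR p := by rw [hb, mul_pow, cbrt_pow_three, cbrt_pow_three]
  have ha3 : a ^ 3 = fibR (p + q) := by rw [ha, cbrt_pow_three]
  have h4 := cbrt_zpow_natCast_mul s 4 q
  have h2 := cbrt_zpow_natCast_mul s 2 q
  push_cast at h4 h2
  rw [Bplus, cbrt_zpow_sub_three_mul hs, hb3, ha3]
  simp only [cbrt_mul, cbrt_pow, h4, h2, ← ha]
  rw [hb]
  ring

theorem Bminus_eq {s : ℝ} (hs : s ≠ 0) {p q : ℤ} {b a : ℝ}
    (hb : b = cbrt (s ^ q) * cbrt (fibR p)) (ha : a = cbrt (fibR (p + q))) :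
    Bminus p q s = cbrt (s ^ q) * (s ^ p)⁻¹ / (b ^ 3 + a ^ 3) ^ 3
      * (b ^ 4 - a ^ 4 + 2 * (b * a) * (b ^ 2 - a ^ 2)) := by
  have hb3 : b ^ 3 = s ^ q * fibR p := by rw [hb, mul_pow, cbrt_pow_three, cbrt_pow_three]
  have ha3 : a ^ 3 = fibR (p + q) := by rw [ha, cbrt_pow_three]
  have h4 := cbrt_zpow_natCast_mul s 4 q
  have h2 := cbrt_zpow_natCast_mul s 2 q
  push_cast at h4 h2
  rw [Bminus, cbrt_zpow_sub_three_mul hs, hb3, ha3]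
  simp only [cbrt_mul, cbrt_pow, h4, h2, ← ha]
  rw [hb]
  ring

theorem goldenRatio_zpow_mul_fib_sub (p q : ℤ) :
    φ ^ p * (fibR (p + q) - φ ^ q * fibR p) = (-1) ^ p * fibR q := by
  have h5 : (√5 : ℝ) ≠ 0 := by positivity
  have h : φ ^ p * ψ ^ p = (-1) ^ p := by rw [← mul_zpow, goldenRatio_mul_goldenConj]
  simp only [fibR, coe_intFib_eq]
  rw [← h, zpow_add₀ goldenRatio_ne_zero, zpow_add₀ goldenConj_ne_zero]
  field_simp
  ring

theorem fib_sub_goldenConj_zpow_mul_fib (p q : ℤ) :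
    fibR (p + q) - ψ ^ q * fibR p = φ ^ p * fibR q := by
  have h5 : (√5 : ℝ) ≠ 0 := by positivity
  simp only [fibR, coe_intFib_eq]
  rw [zpow_add₀ goldenRatio_ne_zero, zpow_add₀ goldenConj_ne_zero]
  field_simp
  ring

theorem goldenConj_zpow_mul_fib_sub (p q : ℤ) :
    ψ ^ p * (fibR (p + q) - ψ ^ q * fibR p) = (-1) ^ p * fibR q := by
  rw [fib_sub_goldenConj_zpow_mul_fib, ← mul_assoc, ← mul_zpow, goldenConj_mul_goldenRatio]

/-- The term `(-1)^k (27 F_p F_{p+q} / F_q²)^k s^((2p+q)k)` as a power of `-27 τ / (1 - τ)²`. -/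
theorem series_argument_eq {s : ℝ} (hs : s ≠ 0) {p q : ℤ} (hq : fibR q ≠ 0)
    (h : s ^ p * (fibR (p + q) - s ^ q * fibR p) = (-1) ^ p * fibR q) :
    -1 * (27 * fibR p * fibR (p + q) / fibR q ^ 2) * s ^ (2 * p + q)
      = -27 * (s ^ q * fibR p) * fibR (p + q) / (fibR (p + q) - s ^ q * fibR p) ^ 2 := by
  have hsp : s ^ p ≠ 0 := zpow_ne_zero _ hs
  have hne : fibR (p + q) - s ^ q * fibR p ≠ 0 := by
    intro h0
    rw [h0, mul_zero] at h
    exact mul_ne_zero (zpow_ne_zero _ (by norm_num)) hq h.symm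
  have h2 : fibR q ^ 2 = (s ^ p) ^ 2 * (fibR (p + q) - s ^ q * fibR p) ^ 2 := by
    rw [← mul_pow, h, mul_pow, neg_one_zpow_sq, one_mul]
  rw [h2, zpow_add₀ hs, mul_comm 2 p, zpow_mul, zpow_ofNat]
  field_simp

theorem seriesTerm_eq {G : ℤ → ℝ} {c d : ℝ} (hG : ∀ n, G n = c * φ ^ n + d * ψ ^ n) (p q : ℤ)
    (k : ℕ) :
    seriesTerm G p q k = (-1) ^ p * (
      c * ((-1 * (27 * fibR p * fibR (p + q) / fibR q ^ 2) * φ ^ (2 * p + q)) ^ k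
        / (Nat.choose (3 * k) k : ℝ))
      + d * ((-1 * (27 * fibR p * fibR (p + q) / fibR q ^ 2) * ψ ^ (2 * p + q)) ^ k
        / (Nat.choose (3 * k) k : ℝ))) := by
  have h1 : (-1 : ℝ) ^ ((k : ℤ) - p) = (-1) ^ k * (-1) ^ p := by
    rw [sub_eq_add_neg, zpow_add₀ (by norm_num), zpow_neg, ← inv_zpow, zpow_natCast]
    norm_num
  rw [seriesTerm, hG, h1]
  simp only [mul_pow, zpow_mul, zpow_natCast]
  ring

theorem hasSum_of_ratio {x y t : ℝ} (hx : x ≠ 0) (ht : t ^ 3 = y / x) (h1 : -(1 / 4) < t ^ 3)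
    (h2 : t ^ 3 < 1 / 6) :
    HasSum (fun k : ℕ => (-27 * x * y / (x - y) ^ 2) ^ (k + 1)
      / (Nat.choose (3 * (k + 1)) (k + 1) : ℝ)) (invChooseSum t) := by
  have h := hasSum_pow_div_choose h1 h2
  have hne : x - y ≠ 0 := by
    intro h0
    rw [ht, ← sub_eq_zero.mp h0, div_self hx] at h2
    norm_num at h2
  have : -27 * t ^ 3 / (1 - t ^ 3) ^ 2 = -27 * x * y / (x - y) ^ 2 := by
    have h3 : 1 - t ^ 3 = (x - y) / x := by rw [ht]; field_simp
    rw [h3, ht]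
    field_simp
  rwa [this] at h

variable {p q : ℤ}

theorem mul_invChooseSum_goldenRatio (hp : fibR p ≠ 0) (hpq : fibR (p + q) ≠ 0) (hq : fibR q ≠ 0) :
    (-1) ^ p / (fibR q * cbrt (fibR p * fibR (p + q)))
        * invChooseSum (cbrt (fibR (p + q)) / (cbrt (φ ^ q) * cbrt (fibR p)))
      = (-1) ^ p / (fibR q * cbrt (fibR p * fibR (p + q)))
          * (-4 * (φ ^ q * fibR p) * fibR (p + q) / (φ ^ q * fibR p + fibR (p + q)) ^ 2)
        - 2 / √3 * (Bplus p q φ * arctanOne p q) + 1 / 3 * (Bminus p q φ * logOne p q) := by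
  obtain ⟨b, hb⟩ : ∃ b, b = cbrt (φ ^ q) * cbrt (fibR p) := ⟨_, rfl⟩
  obtain ⟨a, ha⟩ : ∃ a, a = cbrt (fibR (p + q)) := ⟨_, rfl⟩
  have hc0 : cbrt (φ ^ q) ≠ 0 := cbrt_ne_zero (zpow_ne_zero _ goldenRatio_ne_zero)
  have hP0 := cbrt_ne_zero hp
  have ha0 : a ≠ 0 := ha ▸ cbrt_ne_zero hpq
  have hb0 : b ≠ 0 := hb ▸ mul_ne_zero hc0 hP0
  have hb3 : b ^ 3 = φ ^ q * fibR p := by rw [hb, mul_pow, cbrt_pow_three, cbrt_pow_three]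
  have ha3 : a ^ 3 = fibR (p + q) := by rw [ha, cbrt_pow_three]
  have hφp : φ ^ p ≠ 0 := zpow_ne_zero _ goldenRatio_ne_zero
  have hF := goldenRatio_zpow_mul_fib_sub p q
  rw [← hb3, ← ha3] at hF
  have hT : arctanOne p q = arctan (√3 * a / (2 * b + a)) := by
    rw [arctanOne, cbrt_mul, ← hb, ← ha]
  have hL : logOne p q = log ((b ^ 3 - a ^ 3) / (b - a) ^ 3) := by
    have h1 : cbrt (φ ^ (p + q) * fibR p) = cbrt (φ ^ p) * b := by
      rw [zpow_add₀ goldenRatio_ne_zero, cbrt_mul, cbrt_mul, hb, mul_assoc]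
    rw [logOne, ← hF, cbrt_mul, ← ha, h1, ← mul_sub, mul_pow, cbrt_pow_three,
      mul_div_mul_left _ _ hφp, ← neg_sub (b ^ 3), ← neg_sub b, Odd.neg_pow (by decide), neg_div_neg_eq]
  have hpre : (-1) ^ p / (fibR q * cbrt (fibR p * fibR (p + q))) * ((b ^ 3 - a ^ 3) * (a * b))
      = -(cbrt (φ ^ q) * (φ ^ p)⁻¹) := by
    rw [cbrt_mul, ← ha]
    have h : b ^ 3 - a ^ 3 = -((-1) ^ p * fibR q * (φ ^ p)⁻¹) := by
      rw [← hF]; field_simp; ring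
    rw [h, hb]
    field_simp
    linear_combination (-1) * neg_one_zpow_sq p
  rw [← ha, ← hb, invChooseSum_div hb0, hT, hL, Bplus_eq goldenRatio_ne_zero hb ha,
    Bminus_eq goldenRatio_ne_zero hb ha, ← hb3, ← ha3]
  rw [ha3]
  generalize (-1) ^ p / (fibR q * cbrt (fibR p * fibR (p + q))) = w at *
  rw [← ha3]
  linear_combination (2 / √3 * ((b ^ 4 + a ^ 4 - 2 * (b * a) * (b ^ 2 + a ^ 2))
          / (b ^ 3 + a ^ 3) ^ 3) * arctan (√3 * a / (2 * b + a))
      - 1 / 3 * ((b ^ 4 - a ^ 4 + 2 * (b * a) * (b ^ 2 - a ^ 2))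
          / (b ^ 3 + a ^ 3) ^ 3) * log ((b ^ 3 - a ^ 3) / (b - a) ^ 3)) * hpre

theorem mul_invChooseSum_goldenConj (hp : fibR p ≠ 0) (hpq : fibR (p + q) ≠ 0) (hq : fibR q ≠ 0) :
    (-1) ^ p / (fibR q * cbrt (fibR p * fibR (p + q)))
        * invChooseSum (cbrt (ψ ^ q) * cbrt (fibR p) / cbrt (fibR (p + q)))
      = (-1) ^ p / (fibR q * cbrt (fibR p * fibR (p + q)))
          * (-4 * (ψ ^ q * fibR p) * fibR (p + q) / (ψ ^ q * fibR p + fibR (p + q)) ^ 2)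
        + 2 / √3 * (Bplus p q ψ * arctanTwo p q) + 1 / 3 * (Bminus p q ψ * logTwo p q) := by
  obtain ⟨b, hb⟩ : ∃ b, b = cbrt (ψ ^ q) * cbrt (fibR p) := ⟨_, rfl⟩
  obtain ⟨a, ha⟩ : ∃ a, a = cbrt (fibR (p + q)) := ⟨_, rfl⟩
  obtain ⟨η, hη⟩ : ∃ η : ℝ, η = (-1) ^ q := ⟨_, rfl⟩
  have hη2 : η ^ 2 = 1 := by rw [hη, neg_one_zpow_sq]
  have hη3 : η ^ 3 = η := by linear_combination η * hη2
  have hη0 : η ≠ 0 := by rintro rfl; norm_num at hη2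
  have hc0 : cbrt (ψ ^ q) ≠ 0 := cbrt_ne_zero (zpow_ne_zero _ goldenConj_ne_zero)
  have hd0 : cbrt (φ ^ q) ≠ 0 := cbrt_ne_zero (zpow_ne_zero _ goldenRatio_ne_zero)
  have hP0 := cbrt_ne_zero hp
  have ha0 : a ≠ 0 := ha ▸ cbrt_ne_zero hpq
  have hb3 : b ^ 3 = ψ ^ q * fibR p := by rw [hb, mul_pow, cbrt_pow_three, cbrt_pow_three]
  have ha3 : a ^ 3 = fibR (p + q) := by rw [ha, cbrt_pow_three]
  have hψp : ψ ^ p ≠ 0 := zpow_ne_zero _ goldenConj_ne_zero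
  have hF := goldenConj_zpow_mul_fib_sub p q
  rw [← hb3, ← ha3] at hF
  have hcd : cbrt (φ ^ q) * cbrt (ψ ^ q) = η := by
    rw [← cbrt_mul, ← mul_zpow, goldenRatio_mul_goldenConj, ← hη]
    exact cbrt_eq_of_pow_three hη3
  have hdb : cbrt (φ ^ q) * b = η * cbrt (fibR p) := by rw [hb, ← mul_assoc, hcd]
  have hT : arctanTwo p q = arctan (√3 * b / (2 * a + b)) := by
    rw [arctanTwo, cbrt_mul, ← ha, ← hη, ← mul_div_mul_left _ _ hη0,
      ← mul_div_mul_left (√3 * b) _ hd0]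
    congr 2
    · linear_combination (-√3) * hdb
    · linear_combination (2 * cbrt (φ ^ q) * a) * hη2 - hdb
  have hL : logTwo p q = log ((a ^ 3 - b ^ 3) / (a - b) ^ 3) := by
    have h1 : φ ^ (p + q) * fibR q = cbrt (φ ^ q) ^ 3 * (a ^ 3 - b ^ 3) := by
      rw [zpow_add₀ goldenRatio_ne_zero, ha3, hb3, fib_sub_goldenConj_zpow_mul_fib,
        cbrt_pow_three]
      ring
    rw [logTwo, h1, cbrt_mul, ← ha, ← hη, ← hdb, ← mul_sub, mul_pow,
      mul_div_mul_left _ _ (pow_ne_zero 3 hd0)]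
  have hpre : (-1) ^ p / (fibR q * cbrt (fibR p * fibR (p + q))) * ((a ^ 3 - b ^ 3) * (b * a))
      = cbrt (ψ ^ q) * (ψ ^ p)⁻¹ := by
    rw [cbrt_mul, ← ha]
    have h : a ^ 3 - b ^ 3 = (-1) ^ p * fibR q * (ψ ^ p)⁻¹ := by
      rw [← hF]; field_simp
    rw [h, hb]
    field_simp
    linear_combination neg_one_zpow_sq p
  rw [← ha, ← hb, invChooseSum_div ha0, hT, hL, Bplus_eq goldenConj_ne_zero hb ha,
    Bminus_eq goldenConj_ne_zero hb ha, ← hb3]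
  generalize (-1) ^ p / (fibR q * cbrt (fibR p * fibR (p + q))) = w at *
  rw [← ha3, add_comm (a ^ 3)]
  linear_combination (2 / √3 * ((b ^ 4 + a ^ 4 - 2 * (b * a) * (b ^ 2 + a ^ 2))
          / (b ^ 3 + a ^ 3) ^ 3) * arctan (√3 * b / (2 * a + b))
      + 1 / 3 * ((b ^ 4 - a ^ 4 + 2 * (b * a) * (b ^ 2 - a ^ 2))
          / (b ^ 3 + a ^ 3) ^ 3) * log ((a ^ 3 - b ^ 3) / (a - b) ^ 3)) * hpre

end

theorem fibR_neg_natCast (n : ℕ) : fibR (-(n : ℤ)) = (-1) ^ (n + 1) * Nat.fib n := by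
  rw [fibR, Int.fib_neg_natCast]
  push_cast
  rfl

theorem ratio_goldenRatio {M P : ℕ} :
    fibR M / (Real.goldenRatio ^ ((M : ℤ) + P) * fibR (-(P : ℤ)))
      = (-1) ^ (P + 1) * Nat.fib M / (Real.goldenRatio ^ (M + P) * Nat.fib P) := by
  have h : ((-1 : ℝ) ^ (P + 1))⁻¹ = (-1) ^ (P + 1) := by rw [← inv_pow]; norm_num
  rw [fibR_neg_natCast, fibR, Int.fib_natCast, Int.cast_natCast,
    show ((M : ℤ) + P) = ((M + P : ℕ) : ℤ) by push_cast; rfl, zpow_natCast,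
    ← mul_assoc, mul_comm (_ ^ (M + P)), mul_assoc, ← div_div, div_right_comm,
    div_eq_mul_inv _ ((-1 : ℝ) ^ (P + 1)), h]
  ring

theorem ratio_goldenConj {M P : ℕ} :
    Real.goldenConj ^ ((M : ℤ) + P) * fibR (-(P : ℤ)) / fibR M
      = (-1) ^ (M + 1) * Nat.fib P / (Real.goldenRatio ^ (P + M) * Nat.fib M) := by
  have h : Real.goldenConj = -Real.goldenRatio⁻¹ := by
    rw [Real.inv_goldenRatio, neg_neg]
  have h2 : ((-1 : ℝ) ^ P) ^ 2 = 1 := by rw [← pow_mul, mul_comm, pow_mul]; simp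
  rw [fibR_neg_natCast, fibR, Int.fib_natCast, Int.cast_natCast,
    show ((M : ℤ) + P) = ((M + P : ℕ) : ℤ) by push_cast; rfl, zpow_natCast, h,
    neg_pow, inv_pow, add_comm P M, mul_comm _ (Nat.fib M : ℝ), ← div_div, div_right_comm]
  have h3 : (-1 : ℝ) ^ (M + P) * (-1) ^ (P + 1) = (-1) ^ (M + 1) := by
    rw [pow_add, pow_add, pow_add]
    linear_combination ((-1 : ℝ) ^ M * (-1) ^ 1) * h2
  rw [← h3]
  ring

theorem fibR_eq (n : ℤ) :
    fibR n = 1 / Real.sqrt 5 * Real.goldenRatio ^ n + -(1 / Real.sqrt 5) * Real.goldenConj ^ n := by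
  rw [fibR, Real.coe_intFib_eq]
  ring

theorem rational_part_fib {ε F η A B x y w : ℝ} (hF : F ≠ 0) (hw : w ≠ 0) (hA : y + A * x ≠ 0)
    (hB : y + B * x ≠ 0) (hw3 : w ^ 3 = x * y) (hη : A * B = η) (hAB : A - B = Real.sqrt 5 * F) :
    1 / Real.sqrt 5 * (ε / (F * w) * (-4 * (A * x) * y / (A * x + y) ^ 2))
        - 1 / Real.sqrt 5 * (ε / (F * w) * (-4 * (B * x) * y / (B * x + y) ^ 2))
      = 4 * -ε * w ^ 2 * (y ^ 2 - η * x ^ 2) / ((y + A * x) ^ 2 * (y + B * x) ^ 2) := by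
  have h5 : Real.sqrt 5 ≠ 0 := by positivity
  have h : A / (A * x + y) ^ 2 - B / (B * x + y) ^ 2
      = Real.sqrt 5 * F * (y ^ 2 - η * x ^ 2) / ((y + A * x) ^ 2 * (y + B * x) ^ 2) := by
    rw [add_comm (A * x), add_comm (B * x), div_sub_div _ _ (pow_ne_zero 2 hA) (pow_ne_zero 2 hB),
      ← hAB, ← hη]
    congr 1
    ring
  have e : y * x / w = w ^ 2 := by rw [mul_comm, ← hw3]; field_simp
  calc _ = -4 * ε / (Real.sqrt 5 * F) * (y * x / w)
        * (A / (A * x + y) ^ 2 - B / (B * x + y) ^ 2) := by ring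
    _ = _ := by rw [h, e]; field_simp

theorem rational_part_lucas {ε F L η A B x y w : ℝ} (hw : w ≠ 0)
    (hA : y + A * x ≠ 0) (hB : y + B * x ≠ 0) (hw3 : w ^ 3 = x * y) (hη : A * B = η)
    (hη2 : η ^ 2 = 1) (hL : L = A + B) :
    ε / (F * w) * (-4 * (A * x) * y / (A * x + y) ^ 2)
        + ε / (F * w) * (-4 * (B * x) * y / (B * x + y) ^ 2)
      = 4 * -(ε * η) * w ^ 2 / F * ((x ^ 2 * L + η * y ^ 2 * L + 4 * x * y)
          / ((y + A * x) ^ 2 * (y + B * x) ^ 2)) := by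
  have h : A / (A * x + y) ^ 2 + B / (B * x + y) ^ 2
      = η * ((x ^ 2 * L + η * y ^ 2 * L + 4 * x * y)
        / ((y + A * x) ^ 2 * (y + B * x) ^ 2)) := by
    rw [add_comm (A * x), add_comm (B * x), div_add_div _ _ (pow_ne_zero 2 hA) (pow_ne_zero 2 hB),
      hL, ← mul_div_assoc]
    congr 1
    linear_combination (x ^ 2 * (A + B) + 4 * x * y) * hη - y ^ 2 * (A + B) * hη2
  have e : y * x / w = w ^ 2 := by rw [mul_comm, ← hw3]; field_simp
  calc _ = -4 * ε / F * (y * x / w) * (A / (A * x + y) ^ 2 + B / (B * x + y) ^ 2) := by ring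
    _ = _ := by rw [h, e]; ring

theorem theorem10 (p q : ℤ) (hp : p ≤ -2) (hq : 4 ≤ q) (hpq : |p| + 1 < |q|) :
    (Summable (fun k : ℕ => seriesTerm fibR p q (k + 1)) ∧
      1 / (fibR q * cbrt (fibR p * fibR (p + q))) * ∑' k : ℕ, seriesTerm fibR p q (k + 1)
        = 4 * (-1 : ℝ) ^ (p - 1) * cbrt (fibR (p + q) ^ 2 * fibR p ^ 2)
              * (fibR (p + q) ^ 2 - (-1 : ℝ) ^ q * fibR p ^ 2)
            / ((fibR (p + q) + Real.goldenRatio ^ q * fibR p) ^ 2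
              * (fibR (p + q) + Real.goldenConj ^ q * fibR p) ^ 2)
          - 2 * Real.sqrt 15 / 15
            * (Bplus p q Real.goldenRatio * arctanOne p q
              + Bplus p q Real.goldenConj * arctanTwo p q)
          + Real.sqrt 5 / 15
            * (Bminus p q Real.goldenRatio * logOne p q
              - Bminus p q Real.goldenConj * logTwo p q)) ∧
    (Summable (fun k : ℕ => seriesTerm lucR p q (k + 1)) ∧
      1 / (fibR q * cbrt (fibR p * fibR (p + q))) * ∑' k : ℕ, seriesTerm lucR p q (k + 1)
        = 4 * (-1 : ℝ) ^ (p - q - 1) * cbrt (fibR (p + q) ^ 2 * fibR p ^ 2) / fibR q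
            * ((fibR p ^ 2 * lucR q + (-1 : ℝ) ^ q * fibR (p + q) ^ 2 * lucR q
                + 4 * fibR p * fibR (p + q))
              / ((fibR (p + q) + Real.goldenRatio ^ q * fibR p) ^ 2
                * (fibR (p + q) + Real.goldenConj ^ q * fibR p) ^ 2))
          - 2 / Real.sqrt 3
            * (Bplus p q Real.goldenRatio * arctanOne p q
              - Bplus p q Real.goldenConj * arctanTwo p q)
          + 1 / 3
            * (Bminus p q Real.goldenRatio * logOne p q
              + Bminus p q Real.goldenConj * logTwo p q)) := by
  obtain ⟨P, rfl⟩ : ∃ P : ℕ, p = -(P : ℤ) := ⟨p.natAbs, by omega⟩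
  have hP : 2 ≤ P := by omega
  obtain ⟨M, rfl⟩ : ∃ M : ℕ, q = M + P := by
    refine ⟨(q - P).toNat, ?_⟩
    rw [abs_of_nonpos (by omega), abs_of_pos (by omega)] at hpq
    omega
  have hM : 2 ≤ M := by
    rw [abs_of_nonpos (by omega), abs_of_pos (by omega)] at hpq
    omega
  obtain ⟨p, hpdef⟩ : ∃ p : ℤ, p = -(P : ℤ) := ⟨_, rfl⟩
  obtain ⟨q, hqdef⟩ : ∃ q : ℤ, q = M + P := ⟨_, rfl⟩
  have hpM : (M : ℤ) = p + q := by omega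
  obtain ⟨h1α, h2α⟩ := fib_ratio_bounds hM hP ratio_goldenRatio
  obtain ⟨h1β, h2β⟩ := fib_ratio_bounds hP hM ratio_goldenConj
  rw [hpM, ← hpdef, ← hpM, ← hqdef, hpM] at h1α h2α h1β h2β
  rw [← hpdef, ← hqdef]
  have hF0 : ∀ n : ℤ, n ≠ 0 → fibR n ≠ 0 := fun n hn => by
    rw [fibR, Int.cast_ne_zero]; exact Int.fib_eq_zero.not.mpr hn
  have hFp : fibR p ≠ 0 := hF0 p (by omega)
  have hFq : fibR q ≠ 0 := hF0 q (by omega)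
  have hFpq : fibR (p + q) ≠ 0 := hF0 _ (by omega)
  have hα0 : Real.goldenRatio ^ q * fibR p ≠ 0 :=
    mul_ne_zero (zpow_ne_zero _ Real.goldenRatio_ne_zero) hFp
  have htα : (cbrt (fibR (p + q)) / (cbrt (Real.goldenRatio ^ q) * cbrt (fibR p))) ^ 3
      = fibR (p + q) / (Real.goldenRatio ^ q * fibR p) := by
    rw [div_pow, mul_pow, cbrt_pow_three, cbrt_pow_three, cbrt_pow_three]
  have htβ : (cbrt (Real.goldenConj ^ q) * cbrt (fibR p) / cbrt (fibR (p + q))) ^ 3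
      = Real.goldenConj ^ q * fibR p / fibR (p + q) := by
    rw [div_pow, mul_pow, cbrt_pow_three, cbrt_pow_three, cbrt_pow_three]
  have hα := hasSum_of_ratio hα0 htα (htα ▸ h1α) (htα ▸ h2α)
  have hβ := hasSum_of_ratio hFpq htβ (htβ ▸ h1β) (htβ ▸ h2β)
  have hneα : fibR (p + q) + Real.goldenRatio ^ q * fibR p ≠ 0 := by
    intro h
    rw [eq_neg_of_add_eq_zero_left h, neg_div, div_self hα0] at h1α
    norm_num at h1α
  have hneβ : fibR (p + q) + Real.goldenConj ^ q * fibR p ≠ 0 := by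
    intro h
    rw [eq_neg_of_add_eq_zero_right h, neg_div, div_self hFpq] at h1β
    norm_num at h1β
  rw [show -27 * (Real.goldenRatio ^ q * fibR p) * fibR (p + q)
      / (Real.goldenRatio ^ q * fibR p - fibR (p + q)) ^ 2
      = -1 * (27 * fibR p * fibR (p + q) / fibR q ^ 2) * Real.goldenRatio ^ (2 * p + q) by
    rw [series_argument_eq Real.goldenRatio_ne_zero hFq (goldenRatio_zpow_mul_fib_sub p q),
      ← neg_sub (fibR (p + q)), neg_sq]] at hα
  rw [show -27 * fibR (p + q) * (Real.goldenConj ^ q * fibR p)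
      / (fibR (p + q) - Real.goldenConj ^ q * fibR p) ^ 2
      = -1 * (27 * fibR p * fibR (p + q) / fibR q ^ 2) * Real.goldenConj ^ (2 * p + q) by
    rw [series_argument_eq Real.goldenConj_ne_zero hFq (goldenConj_zpow_mul_fib_sub p q)]
    ring] at hβ
  have hsum : ∀ {G : ℤ → ℝ} {c d : ℝ},
      (∀ n, G n = c * Real.goldenRatio ^ n + d * Real.goldenConj ^ n) →
      HasSum (fun k : ℕ => seriesTerm G p q (k + 1)) ((-1) ^ p *
        (c * invChooseSum (cbrt (fibR (p + q)) / (cbrt (Real.goldenRatio ^ q) * cbrt (fibR p)))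
        + d * invChooseSum (cbrt (Real.goldenConj ^ q) * cbrt (fibR p) / cbrt (fibR (p + q))))) := by
    intro G c d hG
    simp only [seriesTerm_eq hG]
    exact ((hα.mul_left c).add (hβ.mul_left d)).mul_left _
  have hfib := hsum fibR_eq
  have hluc := hsum (G := lucR) (c := 1) (d := 1) (fun n => by rw [lucR_eq]; ring)
  have hVα := mul_invChooseSum_goldenRatio hFp hFpq hFq
  have hVβ := mul_invChooseSum_goldenConj hFp hFpq hFq
  have hcb : cbrt (fibR (p + q) ^ 2 * fibR p ^ 2) = cbrt (fibR p * fibR (p + q)) ^ 2 := by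
    rw [← cbrt_pow]; congr 1; ring
  have hw3 : cbrt (fibR p * fibR (p + q)) ^ 3 = fibR p * fibR (p + q) := cbrt_pow_three _
  have hw0 : cbrt (fibR p * fibR (p + q)) ≠ 0 := cbrt_ne_zero (mul_ne_zero hFp hFpq)
  have hAB : Real.goldenRatio ^ q * Real.goldenConj ^ q = (-1) ^ q := by
    rw [← mul_zpow, Real.goldenRatio_mul_goldenConj]
  have h5 : Real.sqrt 5 ≠ 0 := by positivity
  have h55 : Real.sqrt 5 ^ 2 = 5 := by norm_num
  have h3 : Real.sqrt 3 ≠ 0 := by positivity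
  have h33 : Real.sqrt 3 ^ 2 = 3 := by norm_num
  have h15 : Real.sqrt 15 = Real.sqrt 3 * Real.sqrt 5 := by
    rw [← Real.sqrt_mul (by norm_num)]; norm_num
  have hBinet : Real.goldenRatio ^ q - Real.goldenConj ^ q = Real.sqrt 5 * fibR q := by
    rw [fibR, Real.coe_intFib_eq]; field_simp
  have hL := lucR_eq q
  have hp1 : (-1 : ℝ) ^ (p - 1) = -(-1) ^ p := by
    rw [zpow_sub_one₀ (by norm_num)]; norm_num
  have hpq1 : (-1 : ℝ) ^ (p - q - 1) = -((-1) ^ p * (-1) ^ q) := by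
    rw [zpow_sub_one₀ (by norm_num), sub_eq_add_neg, zpow_add₀ (by norm_num), zpow_neg,
      ← inv_zpow]
    norm_num
  refine ⟨⟨hfib.summable, ?_⟩, ⟨hluc.summable, ?_⟩⟩
  · rw [hfib.tsum_eq, hcb, hp1, ← rational_part_fib hFq hw0 hneα hneβ hw3 hAB hBinet, h15]
    have e1 : 2 * (Real.sqrt 3 * Real.sqrt 5) / 15 = 1 / Real.sqrt 5 * (2 / Real.sqrt 3) := by
      field_simp; rw [h33, h55]; norm_num
    have e2 : Real.sqrt 5 / 15 = 1 / Real.sqrt 5 * (1 / 3) := by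
      field_simp; rw [h55]; norm_num
    rw [e1, e2]
    linear_combination 1 / Real.sqrt 5 * hVα - 1 / Real.sqrt 5 * hVβ
  · rw [hluc.tsum_eq, hcb, hpq1, ← rational_part_lucas hw0 hneα hneβ hw3 hAB (neg_one_zpow_sq q) hL]
    linear_combination hVα + hVβ
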